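/- Let $K\ge 1$, $\sigma^2>0$ and $\theta\in\mathbb R^K$ with a unique best arm $I^*=\arg\max_i\theta_i$. Let $Y_1,Y_2,\ldots$ be independent random vectors of potential outcomes $Y_s=(Y_{s,1},\dots,Y_{s,K})$ with $Y_{s,i}\sim N(\theta_i,\sigma^2)$. A non-anticipating algorithm assigns to the $s$-th unit an arm $A_s$ that is a measurable function of the past observations $A_1,Y_{1,A_1},\dots,A_{s-1},Y_{s-1,A_{s-1}}$ and of a random seed independent of all outcomes (the rule may also depend on the total sample size; quantities indexed by $t$ below are those of the experiment with sample size $t$). Let $N_{t,i}=\sum_{s\le t}\mathbb 1(A_s=i)$, let $p_t=(N_{t,i}/t)_i\in\Sigma_K$ be the empirical allocation, where $\Sigma_K$ is the probability simplex, and let $m_{t,i}=N_{t,i}^{-1}\sum_{s\le t}\mathbb 1(A_s=i)Y_{s,i}$ be the empirical means, with $m_{t,i}=0$ if $N_{t,i}=0$. Write $d(a,b)=\frac{(a-b)^2}{2\sigma^2}$ for the Kullback–Leibler divergence between $N(a,\sigma^2)$ and $N(b,\sigma^2)$, and $\Psi_\theta(\lambda,p)=\sum_{i=1}^K p_i\,d(\lambda_i,\theta_i)$.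 A sequence $(Z_t)$ in a space $S$ is said to satisfy the large deviation (LDP) upper bound with rate function $R:S\to[0,\infty]$ if $R$ is lower semicontinuous and, for every closed $C\subseteq S$, $$\liminf_{t\to\infty}-\tfrac1t\ln\mathbb P(Z_t\in C)\ \ge\ \inf_{x\in C}R(x).$$ Suppose that $(p_t)_{t\ge1}$ satisfies the LDP upper bound on $\Sigma_K$ with rate function $I$. Then: 1. $(m_t)_{t\ge1}$ satisfies the LDP upper bound on $\mathbb R^K$ with rate function $\lambda\mapsto\min_{p\in\Sigma_K}\max\{\Psi_\theta(\lambda,p),I(p)\}$ (and the minimum is attained). 2. For every $n\in\{2,\dots,K\}$, every $J\subseteq\{1,\dots,K\}$ with $|J|=n$ and $I^*\in J$, with $M=\{\lambda\in\mathbb R^K:\lambda_{I^*}\le\lambda_i\ \text{for all } i\in J\}$, and every Borel set $P\subseteq\Sigma_K$, $$\liminf_{t\to\infty}-\tfrac1t\ln\mathbb P\big(m_t\in M,\ p_t\in P\big)\ \ge\ \inf_{p\in\operatorname{cl}(P)}\max\{F_{\theta,M}(p),I(p)\},$$ where $F_{\theta,M}(p)=\inf_{\lambda\in\operatorname{cl}(M)}\Psi_\theta(\lambda,p)$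 and $\operatorname{cl}$ denotes closure. -/

import Mathlib

open MeasureTheory ProbabilityTheory Filter
open scoped ENNReal NNReal

namespace GaussianBandit

noncomputable section

/-! ### Large deviations -/

/-- The exponential decay rate `liminf_{t → ∞} -(1/t) ln μ(E t)` of a sequence of events, as an
extended real number (with `ln 0 = -∞`). -/
def decayExponent {Ω : Type*} [MeasurableSpace Ω] (μ : Measure Ω) (E : ℕ → Set Ω) : EReal :=
  liminf (fun t : ℕ => -(ENNReal.log (μ (E t)) / (t : EReal))) atTop

/-- The sequence `Z` of random elements of the state space `S` satisfies the large deviation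
upper bound with rate function `I`: the function `I : S → [0, ∞]` is lower semicontinuous, and
`limsup (1/t) ln μ(Z t ∈ C) ≤ - inf_C I` for every relatively closed subset `C` of `S`. The
inequality is written with the opposite sign, `inf_C I ≤ liminf -(1/t) ln μ(Z t ∈ C)`. -/
def SatisfiesLDPUpperBound {Ω X : Type*} [MeasurableSpace Ω] [TopologicalSpace X]
    (μ : Measure Ω) (S : Set X) (Z : ℕ → Ω → X) (I : X → ℝ≥0∞) : Prop :=
  LowerSemicontinuousOn I S ∧
    ∀ C : Set X, IsClosed C →
      ((⨅ x ∈ C ∩ S, I x : ℝ≥0∞) : EReal) ≤ decayExponent μ (fun t => {ω | Z t ω ∈ C ∩ S})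

/-! ### Non-anticipating algorithms -/

/-- A non-anticipating, possibly randomized, allocation algorithm for `K` arms. Its value
`rule T s u h` is the arm assigned to unit `s` (units are numbered `0, 1, 2, …`) when the sample
size is `T`, the random seed is `u`, and the history, that is the arms assigned to the units
before `s` together with their observed outcomes, is `h`. An algorithm that does not know the
sample size in advance is one whose rule does not depend on `T`. -/
structure Algorithm (K : ℕ) (U : Type*) [MeasurableSpace U] where
  rule : (T s : ℕ) → U → (Fin s → Fin K × ℝ) → Fin K
  measurable_rule : ∀ T s, Measurable (fun x : U × (Fin s → Fin K × ℝ) => rule T s x.1 x.2)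

namespace Algorithm

variable {K : ℕ} {U : Type*} [MeasurableSpace U]

/-- The arm that the algorithm assigns to unit `s` when the sample size is `T`, the seed is `u`
and the table of potential outcomes is `y`: only the outcome `y r (arm r)` of the arm assigned
to unit `r` is observed. -/
def arm (alg : Algorithm K U) (T : ℕ) (u : U) (y : ℕ → Fin K → ℝ) (s : ℕ) : Fin K :=
  alg.rule T s u (fun r : Fin s => (alg.arm T u y r, y r (alg.arm T u y r)))
termination_by s
decreasing_by all_goals exact r.isLt

/-- The number of units among the `t` units of an experiment with sample size `t` that are
assigned to arm `i`. -/
def count (alg : Algorithm K U) (u : U) (y : ℕ → Fin K → ℝ) (t : ℕ) (i : Fin K) : ℕ :=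
  ((Finset.range t).filter (fun s => alg.arm t u y s = i)).card

/-- The empirical allocation `p_t`. -/
def allocation (alg : Algorithm K U) (u : U) (y : ℕ → Fin K → ℝ) (t : ℕ) : Fin K → ℝ :=
  fun i => (alg.count u y t i : ℝ) / (t : ℝ)

/-- The vector `m_t` of empirical means; it is `0` for an arm that was not assigned. -/
def empMean (alg : Algorithm K U) (u : U) (y : ℕ → Fin K → ℝ) (t : ℕ) : Fin K → ℝ :=
  fun i =>
    if alg.count u y t i = 0 then 0
    else (∑ s ∈ (Finset.range t).filter (fun s => alg.arm t u y s = i), y s i) /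
      (alg.count u y t i : ℝ)

end Algorithm

/-! ### The Gaussian model -/

/-- The potential outcomes `Y s i` (unit `s`, arm `i`) and the seed `ξ` of the algorithm:
`Y s i` has law `N(θ i, v)`, the outcome vectors of different units are independent, and the seed
is independent of all outcomes. No assumption is made on the dependence between the potential
outcomes of one unit under different arms, of which only one is ever observed. -/
structure IsGaussianModel {Ω U : Type*} [MeasurableSpace Ω] [MeasurableSpace U] {K : ℕ}
    (μ : Measure Ω) (θ : Fin K → ℝ) (v : ℝ≥0) (Y : ℕ → Fin K → Ω → ℝ) (ξ : Ω → U) : Prop where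
  measurable_outcome : ∀ s i, Measurable (Y s i)
  measurable_seed : Measurable ξ
  law_outcome : ∀ s i, μ.map (Y s i) = gaussianReal (θ i) v
  indep_units : iIndepFun (fun (s : ℕ) (ω : Ω) (i : Fin K) => Y s i ω) μ
  indep_seed : IndepFun ξ (fun (ω : Ω) (s : ℕ) (i : Fin K) => Y s i ω) μ

/-- `i` is the unique best arm of the instance `θ`. -/
def IsUniqueBestArm {K : ℕ} (θ : Fin K → ℝ) (i : Fin K) : Prop :=
  ∀ j, j ≠ i → θ j < θ i

/-- The Kullback–Leibler divergence `d(a, b)` of `N(a, v)` from `N(b, v)`. -/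
def d (v : ℝ≥0) (a b : ℝ) : ℝ≥0∞ :=
  InformationTheory.klDiv (gaussianReal a v) (gaussianReal b v)

/-- `Ψ_θ(l, p) = ∑ i, p_i d(l_i, θ_i)`. -/
def Psi {K : ℕ} (v : ℝ≥0) (θ l p : Fin K → ℝ) : ℝ≥0∞ :=
  ∑ i, ENNReal.ofReal (p i) * d v (l i) (θ i)

/-- `F_{θ, M}(p) = inf_{l ∈ cl M} Ψ_θ(l, p)`. -/
def F {K : ℕ} (v : ℝ≥0) (θ : Fin K → ℝ) (M : Set (Fin K → ℝ)) (p : Fin K → ℝ) : ℝ≥0∞ :=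
  ⨅ l ∈ closure M, Psi v θ l p

/-- `l ↦ inf_{p ∈ Σ_K} max {Ψ_θ(l, p), I(p)}`. -/
def meanRate {K : ℕ} (v : ℝ≥0) (θ : Fin K → ℝ) (I : (Fin K → ℝ) → ℝ≥0∞)
    (l : Fin K → ℝ) : ℝ≥0∞ :=
  ⨅ p ∈ stdSimplex ℝ (Fin K), max (Psi v θ l p) (I p)

end

end GaussianBandit

/-!
The argument tilts the laws of the observed outcomes, and replaces exponential tightness, which
fails here, by a compactness argument in which the means may escape to infinity.

*Chernoff bound.* Fix `η : Fin K → ℝ` and change the mean of arm `i` from `θ i` to `θ i + v η i`.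
Whatever the algorithm does, the likelihood ratio of the observed outcomes has mean one
(`IsGaussianModel.lintegral_likelihoodRatio`), because the next arm is a function of the seed and
the past, of which the next outcome vector is independent. At time `t` the ratio is
`exp (t g(m_t, p_t))` with `g(l, q) = ∑ i, q i (η i (l i - θ i) - η i ^ 2 v / 2)`, a function of the
empirical means and the allocation only (`likelihoodRatio_eq_exp`). Hence the event
`r ≤ g(m_t, p_t)` has decay exponent at least `r` (`le_decayExponent_tiltExponent`).

*Joint bound.* Both assertions follow from one inequality (`iInf_max_le_decayExponent`): the decay
exponent of `m_t ∈ A, p_t ∈ P` is at least the infimum over `q ∈ closure P` of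
`max (inf_{l ∈ A} Ψ_θ(l, q)) (I q)`. Let `r` be below this infimum. The sets of pairs `(l, q)` that
`(m_t, p_t)` hits with decay exponent at least `r` form an ideal, so it suffices to find such a set
in every ultrafilter on `A × P`. The second component converges to some `q ∈ closure P`. If
`I q > r`, a neighbourhood of `q` is such a set by the hypothesis on the allocations. Otherwise
`inf_{l ∈ A} Ψ_θ(l, q) > r`, and a Chernoff bound applies (`exists_eventually_le_tiltExponent`):
if `|l i| → ∞` for an arm with `q i > 0`, tilting this arm alone suffices; if not, the arms with
`q i > 0` are tilted to their limits `l i`, for which `g → Ψ_θ(l, q)`, and the arms with `q i = 0`,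
whose means are not controlled, are left alone and do not contribute to `Ψ_θ(l, q)` either.

The rate function of the means is a minimum over the compact simplex of a jointly lower
semicontinuous function, so it is attained and lower semicontinuous.
-/

namespace GaussianBandit

open scoped Topology

/-! ### Decay exponents -/

section Decay

variable {Ω : Type*} [MeasurableSpace Ω] {μ : Measure Ω}

lemma decayExponent_eq_neg_expGrowthSup (E : ℕ → Set Ω) :
    decayExponent μ E = -ExpGrowth.expGrowthSup (fun t => μ (E t)) := by
  rw [ExpGrowth.expGrowthSup, ← EReal.liminf_neg]
  rfl

lemma decayExponent_anti_of_eventually {E F : ℕ → Set Ω} (h : ∀ᶠ t in atTop, E t ⊆ F t) :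
    decayExponent μ F ≤ decayExponent μ E := by
  rw [decayExponent_eq_neg_expGrowthSup, decayExponent_eq_neg_expGrowthSup, EReal.neg_le_neg_iff]
  exact ExpGrowth.expGrowthSup_eventually_monotone (h.mono fun t ht => measure_mono ht)

lemma decayExponent_empty : decayExponent μ (fun _ => ∅) = ⊤ := by
  rw [decayExponent_eq_neg_expGrowthSup]
  simp only [measure_empty]
  rw [show (fun _ : ℕ => (0 : ℝ≥0∞)) = 0 from rfl, ExpGrowth.expGrowthSup_zero, EReal.neg_bot]

/-- The decay exponent of a union is governed by the slower of the two sequences. -/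
lemma le_decayExponent_union {E F : ℕ → Set Ω} {r : EReal} (hE : r ≤ decayExponent μ E)
    (hF : r ≤ decayExponent μ F) : r ≤ decayExponent μ (fun t => E t ∪ F t) := by
  rw [decayExponent_eq_neg_expGrowthSup] at *
  rw [EReal.le_neg] at *
  calc ExpGrowth.expGrowthSup (fun t => μ (E t ∪ F t))
      ≤ ExpGrowth.expGrowthSup ((fun t => μ (E t)) + fun t => μ (F t)) :=
        ExpGrowth.expGrowthSup_monotone fun t => measure_union_le _ _
    _ ≤ -r := by
        rw [ExpGrowth.expGrowthSup_add]
        exact sup_le hE hF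

lemma decayExponent_nonneg [IsProbabilityMeasure μ] (E : ℕ → Set Ω) :
    0 ≤ decayExponent μ E := by
  rw [decayExponent_eq_neg_expGrowthSup, EReal.le_neg, neg_zero,
    ← ExpGrowth.expGrowthSup_const (b := 1) one_ne_zero ENNReal.one_ne_top]
  exact ExpGrowth.expGrowthSup_monotone fun t => prob_le_one

lemma le_decayExponent_of_le_exp {E : ℕ → Set Ω} {r : ℝ}
    (h : ∀ᶠ t : ℕ in atTop, μ (E t) ≤ ENNReal.ofReal (Real.exp (-(t * r)))) :
    (r : EReal) ≤ decayExponent μ E := by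
  rw [decayExponent_eq_neg_expGrowthSup, EReal.le_neg]
  refine Eventually.expGrowthSup_le (h.mono fun t ht => ht.trans_eq ?_)
  rw [← EReal.exp_coe]
  congr 1
  push_cast
  rw [EReal.neg_mul, mul_comm]

end Decay

/-! ### The Kullback–Leibler divergence of Gaussian laws -/

lemma gaussianReal_eq_withDensity_gaussianReal (a b : ℝ) {v : ℝ≥0} (hv : v ≠ 0) :
    gaussianReal a v = (gaussianReal b v).withDensity
      (fun x => ENNReal.ofReal (Real.exp ((a - b) / v * x - (a ^ 2 - b ^ 2) / (2 * v)))) := by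
  have hv' : (v : ℝ) ≠ 0 := by exact_mod_cast hv
  rw [gaussianReal_of_var_ne_zero a hv, gaussianReal_of_var_ne_zero b hv,
    ← withDensity_mul _ (measurable_gaussianPDF b v) (by fun_prop)]
  congr 1
  ext x
  simp only [Pi.mul_apply, gaussianPDF, gaussianPDFReal]
  rw [← ENNReal.ofReal_mul (by positivity), mul_assoc (Real.sqrt _)⁻¹, ← Real.exp_add]
  congr 3
  field_simp
  ring

lemma d_eq_ofReal {v : ℝ≥0} (hv : 0 < v) (a b : ℝ) :
    d v a b = ENNReal.ofReal ((a - b) ^ 2 / (2 * v)) := by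
  have hv' : (v : ℝ) ≠ 0 := by exact_mod_cast hv.ne'
  have hac : gaussianReal a v ≪ gaussianReal b v :=
    (gaussianReal_absolutelyContinuous a hv.ne').trans
      (gaussianReal_absolutelyContinuous' b hv.ne')
  have hllr : llr (gaussianReal a v) (gaussianReal b v) =ᵐ[gaussianReal a v]
      fun x => (a - b) / v * x - (a ^ 2 - b ^ 2) / (2 * v) := by
    refine hac.ae_le ?_
    have h := Measure.rnDeriv_withDensity (gaussianReal b v) (f := fun x =>
      ENNReal.ofReal (Real.exp ((a - b) / v * x - (a ^ 2 - b ^ 2) / (2 * v)))) (by fun_prop)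
    rw [← gaussianReal_eq_withDensity_gaussianReal a b hv.ne'] at h
    filter_upwards [h] with x hx
    rw [llr, hx, ENNReal.toReal_ofReal (Real.exp_pos _).le, Real.log_exp]
  have hid : Integrable (fun x : ℝ => x) (gaussianReal a v) :=
    (memLp_id_gaussianReal 1).integrable le_rfl
  have hint : Integrable (fun x => (a - b) / v * x - (a ^ 2 - b ^ 2) / (2 * v))
      (gaussianReal a v) := (hid.const_mul _).sub (integrable_const _)
  rw [d, InformationTheory.klDiv_of_ac_of_integrable hac ((integrable_congr hllr).2 hint),
    integral_congr_ae hllr, integral_sub (hid.const_mul _) (integrable_const _),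
    integral_const_mul, integral_id_gaussianReal]
  simp only [integral_const, probReal_univ, smul_eq_mul, one_mul]
  congr 1
  field_simp
  ring

lemma Psi_eq_ofReal {K : ℕ} {v : ℝ≥0} (hv : 0 < v) (θ l : Fin K → ℝ) {q : Fin K → ℝ}
    (hq : ∀ i, 0 ≤ q i) :
    Psi v θ l q = ENNReal.ofReal (∑ i, q i * ((l i - θ i) ^ 2 / (2 * v))) := by
  rw [Psi, ENNReal.ofReal_sum_of_nonneg fun i _ => mul_nonneg (hq i) (by positivity)]
  refine Finset.sum_congr rfl fun i _ => ?_
  rw [d_eq_ofReal hv, ENNReal.ofReal_mul (hq i)]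

/-! ### The exponential martingale of an algorithm -/

lemma indepFun_prodMk_left {Ω α β γ : Type*} [MeasurableSpace Ω] [MeasurableSpace α]
    [MeasurableSpace β] [MeasurableSpace γ] {μ : Measure Ω} [IsFiniteMeasure μ]
    {X : Ω → α} {V : Ω → β} {Z : Ω → γ} (hX : Measurable X) (hV : Measurable V)
    (hZ : Measurable Z) (hXVZ : IndepFun X (fun ω => (V ω, Z ω)) μ) (hVZ : IndepFun V Z μ) :
    IndepFun (fun ω => (X ω, V ω)) Z μ := by
  have hXV : IndepFun X V μ := hXVZ.comp measurable_id measurable_fst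
  rw [indepFun_iff_map_prod_eq_prod_map_map (by fun_prop) (by fun_prop)] at *
  rw [hXV]
  apply (MeasurableEquiv.prodAssoc.map_measurableEquiv_injective)
  rw [Measure.prodAssoc_prod, ← hVZ, ← hXVZ, Measure.map_map (by fun_prop) (by fun_prop)]
  rfl

section Tilt

variable {K : ℕ} {U : Type*} [MeasurableSpace U]

lemma measurable_eval : Measurable fun x : (Fin K → ℝ) × Fin K => x.1 x.2 :=
  measurable_from_prod_countable_left fun i => measurable_pi_apply i

namespace Algorithm

lemma arm_eq (alg : Algorithm K U) (T : ℕ) (u : U) (y : ℕ → Fin K → ℝ) (s : ℕ) :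
    alg.arm T u y s =
      alg.rule T s u (fun r : Fin s => (alg.arm T u y r, y r (alg.arm T u y r))) := by
  rw [arm]

/-- The arm assigned to unit `s` does not depend on the outcomes of unit `s` and of later units. -/
lemma arm_congr (alg : Algorithm K U) (T : ℕ) (u : U) {y y' : ℕ → Fin K → ℝ} (s : ℕ)
    (h : ∀ r < s, y r = y' r) : alg.arm T u y s = alg.arm T u y' s := by
  induction s using Nat.strong_induction_on with
  | _ s ih =>
    rw [arm_eq, arm_eq]
    congr 1
    funext r
    rw [ih r r.isLt fun q hq => h q (hq.trans r.isLt), h r r.isLt]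

lemma measurable_arm (alg : Algorithm K U) (T s : ℕ) :
    Measurable fun x : U × (ℕ → Fin K → ℝ) => alg.arm T x.1 x.2 s := by
  induction s using Nat.strong_induction_on with
  | _ s ih =>
    simp_rw [fun x : U × (ℕ → Fin K → ℝ) => alg.arm_eq T x.1 x.2 s]
    refine (alg.measurable_rule T s).comp (measurable_fst.prodMk (measurable_pi_lambda _ ?_))
    intro r
    have hr := ih r r.isLt
    refine hr.prodMk (measurable_eval.comp (Measurable.prodMk ?_ hr))
    fun_prop

lemma measurable_observed (alg : Algorithm K U) (T s : ℕ) :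
    Measurable fun x : U × (ℕ → Fin K → ℝ) => x.2 s (alg.arm T x.1 x.2 s) :=
  measurable_eval.comp (Measurable.prodMk (by fun_prop) (alg.measurable_arm T s))

end Algorithm

/-- The logarithm of the density at `x` of `N(θ a + v η a, v)` with respect to `N(θ a, v)`. -/
noncomputable def logTilt (v : ℝ≥0) (θ η : Fin K → ℝ) (a : Fin K) (x : ℝ) : ℝ :=
  η a * (x - θ a) - η a ^ 2 * v / 2

/-- The product over the first `n` units of the densities of the tilted laws of the observed
outcomes with respect to their true laws. -/
noncomputable def likelihoodRatio (alg : Algorithm K U) (v : ℝ≥0) (θ η : Fin K → ℝ) (T n : ℕ)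
    (x : U × (ℕ → Fin K → ℝ)) : ℝ≥0∞ :=
  ∏ s ∈ Finset.range n, ENNReal.ofReal
    (Real.exp (logTilt v θ η (alg.arm T x.1 x.2 s) (x.2 s (alg.arm T x.1 x.2 s))))

lemma measurable_logTilt (v : ℝ≥0) (θ η : Fin K → ℝ) (a : Fin K) :
    Measurable (logTilt v θ η a) := by
  unfold logTilt
  fun_prop

lemma measurable_likelihoodRatio (alg : Algorithm K U) (v : ℝ≥0) (θ η : Fin K → ℝ) (T n : ℕ) :
    Measurable (likelihoodRatio alg v θ η T n) := by
  refine Finset.measurable_prod _ fun s _ => ?_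
  have h : Measurable fun x : Fin K × ℝ => logTilt v θ η x.1 x.2 :=
    measurable_from_prod_countable_right fun a => measurable_logTilt v θ η a
  exact (h.comp ((alg.measurable_arm T s).prodMk
    (alg.measurable_observed T s))).exp.ennreal_ofReal

/-- The table of outcomes with the rows from the `n`-th on replaced by zero. -/
def truncate (n : ℕ) (y : ℕ → Fin K → ℝ) : ℕ → Fin K → ℝ := fun s => if s < n then y s else 0

lemma measurable_truncate (n : ℕ) : Measurable (truncate (K := K) n) := by
  refine measurable_pi_lambda _ fun s => ?_
  unfold truncate
  split_ifs <;> fun_prop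

lemma arm_truncate (alg : Algorithm K U) (T : ℕ) (u : U) (y : ℕ → Fin K → ℝ) {s n : ℕ}
    (hs : s ≤ n) : alg.arm T u (truncate n y) s = alg.arm T u y s :=
  alg.arm_congr T u s fun r hr => by simp [truncate, hr.trans_le hs]

lemma likelihoodRatio_truncate (alg : Algorithm K U) (v : ℝ≥0) (θ η : Fin K → ℝ) (T n : ℕ)
    (u : U) (y : ℕ → Fin K → ℝ) :
    likelihoodRatio alg v θ η T n (u, truncate n y) = likelihoodRatio alg v θ η T n (u, y) := by
  refine Finset.prod_congr rfl fun s hs => ?_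
  have hs' : s < n := Finset.mem_range.1 hs
  simp only [arm_truncate alg T u y hs'.le]
  simp [truncate, hs']

variable {Ω : Type*} [MeasurableSpace Ω] {μ : Measure Ω}
  {θ : Fin K → ℝ} {v : ℝ≥0} {Y : ℕ → Fin K → Ω → ℝ} {ξ : Ω → U}

namespace IsGaussianModel

lemma measurable_row (hY : IsGaussianModel μ θ v Y ξ) (s : ℕ) :
    Measurable fun (ω : Ω) (i : Fin K) => Y s i ω :=
  measurable_pi_lambda _ fun i => hY.measurable_outcome s i

lemma measurable_table (hY : IsGaussianModel μ θ v Y ξ) :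
    Measurable fun (ω : Ω) (s : ℕ) (i : Fin K) => Y s i ω :=
  measurable_pi_lambda _ hY.measurable_row

lemma lintegral_exp_logTilt (hY : IsGaussianModel μ θ v Y ξ) (η : Fin K → ℝ) (n : ℕ)
    (a : Fin K) :
    ∫⁻ ω, ENNReal.ofReal (Real.exp (logTilt v θ η a (Y n a ω))) ∂μ = 1 := by
  have hint : Integrable (fun x => Real.exp (η a * x)) (μ.map (Y n a)) := by
    rw [hY.law_outcome]
    exact integrable_exp_mul_gaussianReal _
  have hint' : Integrable (fun ω => Real.exp (η a * Y n a ω)) μ :=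
    hint.comp_measurable (hY.measurable_outcome n a)
  have heq : (fun ω => Real.exp (logTilt v θ η a (Y n a ω))) =
      fun ω => Real.exp (η a * Y n a ω) * Real.exp (-(η a * θ a) - η a ^ 2 * v / 2) := by
    funext ω
    rw [← Real.exp_add, logTilt]
    congr 1
    ring
  have hmgf : ∫ ω, Real.exp (η a * Y n a ω) ∂μ = Real.exp (θ a * η a + v * η a ^ 2 / 2) :=
    mgf_gaussianReal (hY.law_outcome n a) (η a)
  rw [← ofReal_integral_eq_lintegral_ofReal (by rw [heq]; exact hint'.mul_const _)
    (ae_of_all _ fun ω => (Real.exp_pos _).le), heq, integral_mul_const, hmgf, ← Real.exp_add]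
  ring_nf
  simp

variable [IsProbabilityMeasure μ]

lemma indepFun_past (hY : IsGaussianModel μ θ v Y ξ) (n : ℕ) :
    IndepFun (fun ω => (ξ ω, truncate n fun s i => Y s i ω)) (fun ω i => Y n i ω) μ := by
  have hV : Measurable fun ω => truncate n fun s i => Y s i ω :=
    (measurable_truncate n).comp hY.measurable_table
  refine indepFun_prodMk_left hY.measurable_seed hV (hY.measurable_row n) ?_ ?_
  · exact hY.indep_seed.comp (ψ := fun y : ℕ → Fin K → ℝ => (truncate n y, y n)) measurable_id
      ((measurable_truncate n).prodMk (measurable_pi_apply n))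
  · have h := hY.indep_units.indepFun_finset (Finset.range n) {n} (by simp) hY.measurable_row
    let φ : (Finset.range n → Fin K → ℝ) → ℕ → Fin K → ℝ :=
      fun z s => if hs : s ∈ Finset.range n then z ⟨s, hs⟩ else 0
    have hφ : Measurable φ := by
      refine measurable_pi_lambda _ fun s => ?_
      by_cases hs : s ∈ Finset.range n
      · simp only [φ, hs, dite_true]
        fun_prop
      · simp only [φ, hs, dite_false]
        fun_prop
    have hψ : Measurable fun z : ({n} : Finset ℕ) → Fin K → ℝ => z ⟨n, by simp⟩ :=
      measurable_pi_apply (X := fun _ : ({n} : Finset ℕ) => Fin K → ℝ) ⟨n, by simp⟩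
    have h' := h.comp hφ hψ
    have hφ' : (φ ∘ fun ω (s : Finset.range n) i => Y s i ω) =
        fun ω => truncate n fun s i => Y s i ω := by
      funext ω s
      simp [φ, truncate]
    rw [← hφ']
    exact h'

/-- The likelihood ratio is a martingale of mean one: given the seed and the past, the arm of the
next unit is determined, and its outcome still has the law `N(θ a, v)`. -/
lemma lintegral_likelihoodRatio (hY : IsGaussianModel μ θ v Y ξ) (alg : Algorithm K U)
    (η : Fin K → ℝ) (T n : ℕ) :
    ∫⁻ ω, likelihoodRatio alg v θ η T n (ξ ω, fun s i => Y s i ω) ∂μ = 1 := by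
  induction n with
  | zero => simp [likelihoodRatio]
  | succ n ih =>
    -- The part of the ratio determined by the past, on the event that arm `a` comes next.
    let G : Fin K → U × (ℕ → Fin K → ℝ) → ℝ≥0∞ := fun a =>
      {x | alg.arm T x.1 x.2 n = a}.indicator (likelihoodRatio alg v θ η T n)
    have hG : ∀ a, Measurable (G a) := fun a =>
      (measurable_likelihoodRatio alg v θ η T n).indicator
        (alg.measurable_arm T n (measurableSet_singleton a))
    have hGtrunc : ∀ a u y, G a (u, truncate n y) = G a (u, y) := fun a u y => by
      simp only [G, Set.indicator_apply, Set.mem_ofPred_eq, arm_truncate alg T u y le_rfl,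
        likelihoodRatio_truncate]
    have hXmeas : Measurable fun ω => (ξ ω, fun s i => Y s i ω) :=
      hY.measurable_seed.prodMk hY.measurable_table
    have hsum : ∀ x, likelihoodRatio alg v θ η T n x = ∑ a, G a x := fun x => by
      simp [G, Set.indicator_apply]
    have hstep : ∀ x, likelihoodRatio alg v θ η T (n + 1) x =
        ∑ a, G a x * ENNReal.ofReal (Real.exp (logTilt v θ η a (x.2 n a))) := fun x => by
      simp [G, Set.indicator_apply, likelihoodRatio, Finset.prod_range_succ]
    have hfactor : ∀ a, ∫⁻ ω, G a (ξ ω, fun s i => Y s i ω) *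
          ENNReal.ofReal (Real.exp (logTilt v θ η a (Y n a ω))) ∂μ =
        ∫⁻ ω, G a (ξ ω, fun s i => Y s i ω) ∂μ := fun a => by
      have hψ : Measurable fun z : Fin K → ℝ =>
          ENNReal.ofReal (Real.exp (logTilt v θ η a (z a))) :=
        ((measurable_logTilt v θ η a).comp (measurable_pi_apply a)).exp.ennreal_ofReal
      have hind := (hY.indepFun_past n).comp (hG a) hψ
      simp only [Function.comp_def, hGtrunc] at hind
      have := lintegral_mul_eq_lintegral_mul_lintegral_of_indepFun ((hG a).comp hXmeas)
        (hψ.comp (hY.measurable_row n)) hind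
      simp only [Pi.mul_apply, Function.comp_def] at this
      rw [this, hY.lintegral_exp_logTilt, mul_one]
    simp_rw [hstep]
    rw [lintegral_finsetSum' _ fun a _ => ?_]
    · simp only [hfactor]
      have h := lintegral_finsetSum' (μ := μ) Finset.univ
        fun a _ => ((hG a).comp hXmeas).aemeasurable
      simp only [Function.comp_def, ← hsum] at h
      rw [← h, ih]
    · exact (((hG a).comp hXmeas).mul ((measurable_logTilt v θ η a).comp
        (hY.measurable_outcome n a)).exp.ennreal_ofReal).aemeasurable

end IsGaussianModel

/-- The exponent per unit of the likelihood ratio, as a function of the empirical means `l` and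
the allocation `q`. -/
noncomputable def tiltExponent (v : ℝ≥0) (θ η l q : Fin K → ℝ) : ℝ :=
  ∑ i, q i * logTilt v θ η i (l i)

lemma likelihoodRatio_eq_exp (alg : Algorithm K U) (v : ℝ≥0) (θ η : Fin K → ℝ) {t : ℕ}
    (ht : t ≠ 0) (u : U) (y : ℕ → Fin K → ℝ) :
    likelihoodRatio alg v θ η t t (u, y) = ENNReal.ofReal (Real.exp
      (t * tiltExponent v θ η (alg.empMean u y t) (alg.allocation u y t))) := by
  rw [likelihoodRatio, ← ENNReal.ofReal_prod_of_nonneg fun s _ => (Real.exp_pos _).le,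
    ← Real.exp_sum, ← Finset.sum_fiberwise_of_maps_to (t := Finset.univ)
      (g := fun s => alg.arm t u y s) (fun _ _ => Finset.mem_univ _), tiltExponent,
    Finset.mul_sum]
  congr 2
  refine Finset.sum_congr rfl fun i _ => ?_
  have ht' : (t : ℝ) ≠ 0 := by exact_mod_cast ht
  have h1 : ∑ s ∈ (Finset.range t).filter (fun s => alg.arm t u y s = i),
        logTilt v θ η (alg.arm t u y s) (y s (alg.arm t u y s)) =
      ∑ s ∈ (Finset.range t).filter (fun s => alg.arm t u y s = i),
        (η i * y s i - (η i * θ i + η i ^ 2 * v / 2)) := by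
    refine Finset.sum_congr rfl fun s hs => ?_
    rw [(Finset.mem_filter.1 hs).2, logTilt]
    ring
  have h2 : ∑ s ∈ (Finset.range t).filter (fun s => alg.arm t u y s = i), y s i =
      alg.count u y t i * alg.empMean u y t i := by
    rw [Algorithm.empMean]
    split_ifs with h0
    · rw [Finset.card_eq_zero.1 h0]
      simp
    · have : (alg.count u y t i : ℝ) ≠ 0 := by exact_mod_cast h0
      field_simp
  rw [h1, Finset.sum_sub_distrib, ← Finset.mul_sum, h2, Finset.sum_const, nsmul_eq_mul,
    Algorithm.allocation, logTilt]
  change _ - (alg.count u y t i : ℝ) * _ = _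
  field_simp
  ring

/-- **Chernoff bound** for the empirical means and the allocation. -/
lemma le_decayExponent_tiltExponent [IsProbabilityMeasure μ]
    (hY : IsGaussianModel μ θ v Y ξ) (alg : Algorithm K U) (η : Fin K → ℝ) (r : ℝ) :
    (r : EReal) ≤ decayExponent μ (fun t => {ω | r ≤ tiltExponent v θ η
      (alg.empMean (ξ ω) (fun s i => Y s i ω) t)
      (alg.allocation (ξ ω) (fun s i => Y s i ω) t)}) := by
  refine le_decayExponent_of_le_exp ?_
  filter_upwards [eventually_ne_atTop 0] with t ht
  have hmeas : Measurable fun ω =>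
      likelihoodRatio alg v θ η t t (ξ ω, fun s i => Y s i ω) :=
    (measurable_likelihoodRatio alg v θ η t t).comp
      (hY.measurable_seed.prodMk hY.measurable_table)
  have hmarkov := mul_meas_ge_le_lintegral (μ := μ) hmeas
    (ENNReal.ofReal (Real.exp (t * r)))
  rw [hY.lintegral_likelihoodRatio] at hmarkov
  have hsub : {ω | r ≤ tiltExponent v θ η (alg.empMean (ξ ω) (fun s i => Y s i ω) t)
        (alg.allocation (ξ ω) (fun s i => Y s i ω) t)} ⊆
      {ω | ENNReal.ofReal (Real.exp (t * r)) ≤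
        likelihoodRatio alg v θ η t t (ξ ω, fun s i => Y s i ω)} := fun ω hω => by
    rw [Set.mem_ofPred_eq] at hω
    rw [Set.mem_ofPred_eq, likelihoodRatio_eq_exp alg v θ η ht]
    gcongr
  refine (measure_mono hsub).trans ?_
  rw [Real.exp_neg, ENNReal.ofReal_inv_of_pos (Real.exp_pos _), ENNReal.le_inv_iff_mul_le,
    mul_comm]
  exact hmarkov

end Tilt

/-! ### Ultrafilters in place of a compactification -/

/-- An ideal of sets contains `D` as soon as it meets every ultrafilter that contains `D`. -/
lemma of_forall_ultrafilter_exists_mem {α : Type*} {p : Set α → Prop} (he : p ∅)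
    (hmono : ∀ t, p t → ∀ s ⊆ t, p s) (hunion : ∀ s, p s → ∀ t, p t → p (s ∪ t)) {D : Set α}
    (h : ∀ f : Ultrafilter α, D ∈ f → ∃ U ∈ f, p U) : p D := by
  by_contra hD
  have hne : NeBot (comk p he hmono hunion ⊓ 𝓟 D) := by
    rw [neBot_iff, Ne, inf_principal_eq_bot]
    simpa using hD
  obtain ⟨f, hf⟩ := Ultrafilter.exists_le (comk p he hmono hunion ⊓ 𝓟 D)
  obtain ⟨U, hUf, hU⟩ := h f (le_principal_iff.1 (hf.trans inf_le_right))
  have hUc : Uᶜ ∈ f := (hf.trans inf_le_left) (by simpa using hU)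
  exact (Ultrafilter.compl_mem_iff_notMem.1 hUc) hUf

lemma tendsto_nhds_or_atTop_or_atBot {α : Type*} (f : Ultrafilter α) (x : α → ℝ) :
    (∃ a, Tendsto x f (𝓝 a)) ∨ Tendsto x f atTop ∨ Tendsto x f atBot := by
  by_cases hB : ∃ B, ∀ᶠ z in (f : Filter α), |x z| ≤ B
  · obtain ⟨B, hB⟩ := hB
    obtain ⟨a, -, ha⟩ := (isCompact_Icc (a := -B) (b := B)).ultrafilter_le_nhds' (f.map x)
      (hB.mono fun z hz => abs_le.1 hz)
    exact Or.inl ⟨a, ha⟩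
  · right
    have hB' : ∀ B, ∀ᶠ z in (f : Filter α), B < |x z| := fun B => by
      have := Ultrafilter.eventually_not.2 (not_exists.1 hB B)
      simpa using this
    rcases Ultrafilter.eventually_or.1
      (Eventually.of_forall (f := (f : Filter α)) fun z => le_total 0 (x z)) with h | h
    · refine Or.inl (tendsto_atTop.2 fun B => ?_)
      filter_upwards [h, hB' B] with z h0 h1
      rw [abs_of_nonneg h0] at h1
      exact h1.le
    · refine Or.inr (tendsto_atBot.2 fun B => ?_)
      filter_upwards [h, hB' (-B)] with z h0 h1
      rw [abs_of_nonpos h0] at h1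
      linarith

section Joint

variable {K : ℕ}

lemma tiltExponent_single (v : ℝ≥0) (θ l q : Fin K → ℝ) (i : Fin K) (x : ℝ) :
    tiltExponent v θ (Pi.single i x) l q = q i * (x * (l i - θ i) - x ^ 2 * v / 2) := by
  rw [tiltExponent, Finset.sum_eq_single i]
  · simp [logTilt]
  · intro j _ hj
    simp [logTilt, Pi.single_eq_of_ne hj]
  · simp

/-- A choice of tilt that is nearly optimal along an ultrafilter. If the mean of an arm of positive
limiting weight diverges, tilting that arm alone makes the exponent infinite. Otherwise the arms
of positive limiting weight are tilted to their limiting means, and the other arms, whose means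
may be anywhere, are not tilted. -/
lemma exists_eventually_le_tiltExponent {v : ℝ≥0} (hv : 0 < v) (θ q : Fin K → ℝ)
    (f : Ultrafilter ((Fin K → ℝ) × (Fin K → ℝ))) (hq : ∀ i, 0 ≤ q i)
    (hf : Tendsto Prod.snd (f : Filter ((Fin K → ℝ) × (Fin K → ℝ))) (𝓝 q)) {r c : ℝ}
    (hrc : r < c) (hc : ∀ᶠ z in (f : Filter ((Fin K → ℝ) × (Fin K → ℝ))),
      c ≤ ∑ i, q i * ((z.1 i - θ i) ^ 2 / (2 * v))) :
    ∃ η, ∀ᶠ z in (f : Filter ((Fin K → ℝ) × (Fin K → ℝ))), r ≤ tiltExponent v θ η z.1 z.2 := by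
  have hv' : (v : ℝ) ≠ 0 := by exact_mod_cast hv.ne'
  have hfi : ∀ i, Tendsto (fun z => z.2 i) (f : Filter ((Fin K → ℝ) × (Fin K → ℝ)))
      (𝓝 (q i)) := tendsto_pi_nhds.1 hf
  by_cases hconv : ∀ i, q i ≠ 0 → ∃ a, Tendsto (fun z => z.1 i)
      (f : Filter ((Fin K → ℝ) × (Fin K → ℝ))) (𝓝 a)
  · choose! a ha using hconv
    let η : Fin K → ℝ := fun i => if q i = 0 then 0 else (a i - θ i) / v
    have hlim : Tendsto (fun z => tiltExponent v θ η z.1 z.2)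
        (f : Filter ((Fin K → ℝ) × (Fin K → ℝ)))
        (𝓝 (∑ i, q i * ((a i - θ i) ^ 2 / (2 * v)))) := by
      refine tendsto_finsetSum _ fun i _ => ?_
      by_cases hqi : q i = 0
      · simp [η, hqi, logTilt]
      · have hval : logTilt v θ η i (a i) = (a i - θ i) ^ 2 / (2 * v) := by
          simp only [logTilt, η, hqi, if_false]
          field_simp
          ring
        rw [← hval]
        exact (hfi i).mul ((((ha i hqi).sub_const _).const_mul _).sub_const _)
    have hlim' : Tendsto (fun z => ∑ i, q i * ((z.1 i - θ i) ^ 2 / (2 * v)))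
        (f : Filter ((Fin K → ℝ) × (Fin K → ℝ)))
        (𝓝 (∑ i, q i * ((a i - θ i) ^ 2 / (2 * v)))) := by
      refine tendsto_finsetSum _ fun i _ => ?_
      by_cases hqi : q i = 0
      · simp [hqi]
      · exact ((((ha i hqi).sub_const _).pow 2).div_const _).const_mul _
    exact ⟨η, (hlim.eventually_const_lt (hrc.trans_le (ge_of_tendsto hlim' hc))).mono
      fun z hz => hz.le⟩
  · push Not at hconv
    obtain ⟨i, hqi, hi⟩ := hconv
    have hpos : 0 < q i := lt_of_le_of_ne (hq i) (Ne.symm hqi)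
    have hdiv : ∃ x : ℝ, Tendsto (fun z => x * (z.1 i - θ i) - x ^ 2 * v / 2)
        (f : Filter ((Fin K → ℝ) × (Fin K → ℝ))) atTop := by
      rcases tendsto_nhds_or_atTop_or_atBot f (fun z => z.1 i) with ⟨a, ha⟩ | h | h
      · exact absurd ha (hi a)
      · refine ⟨1, ?_⟩
        convert tendsto_atTop_add_const_right _ (-θ i - v / 2) h using 2
        ring
      · refine ⟨-1, ?_⟩
        convert tendsto_atTop_add_const_right _ (θ i - v / 2) (tendsto_neg_atBot_atTop.comp h)
          using 2
        simp only [Function.comp_apply]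
        ring
    obtain ⟨x, hx⟩ := hdiv
    refine ⟨Pi.single i x, ?_⟩
    simp_rw [tiltExponent_single]
    exact ((hfi i).pos_mul_atTop hpos hx).eventually_ge_atTop r

/-! ### The joint bound for the means and the allocation -/

lemma coe_le_of_forall_nnreal_lt {R : ℝ≥0∞} {x : EReal} (hx : 0 ≤ x)
    (h : ∀ r : ℝ≥0, (r : ℝ≥0∞) < R → ((r : ℝ) : EReal) ≤ x) : (R : EReal) ≤ x := by
  rw [← EReal.coe_toENNReal hx, EReal.coe_ennreal_le_coe_ennreal_iff]
  refine ENNReal.le_of_forall_nnreal_lt fun r hr => ?_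
  rw [← EReal.coe_ennreal_le_coe_ennreal_iff, EReal.coe_toENNReal hx]
  exact h r hr

variable {Ω U : Type*} [MeasurableSpace Ω] [MeasurableSpace U] {μ : Measure Ω}
  [IsProbabilityMeasure μ] {θ : Fin K → ℝ} {v : ℝ≥0} {Y : ℕ → Fin K → Ω → ℝ} {ξ : Ω → U}

/-- The joint large deviation bound behind both assertions. Near a point `q` the event is
controlled by the bound for the allocations if `I q` is large, and by a Chernoff bound if the
divergence `Ψ_θ(l, q)` is large for all means `l ∈ A`. -/
theorem iInf_max_le_decayExponent (hv : 0 < v) (hY : IsGaussianModel μ θ v Y ξ)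
    (alg : Algorithm K U) {I : (Fin K → ℝ) → ℝ≥0∞}
    (hI : SatisfiesLDPUpperBound μ (stdSimplex ℝ (Fin K))
      (fun t ω => alg.allocation (ξ ω) (fun s i => Y s i ω) t) I)
    (A P : Set (Fin K → ℝ)) (hP : P ⊆ stdSimplex ℝ (Fin K)) :
    ((⨅ q ∈ closure P, max (⨅ l ∈ A, Psi v θ l q) (I q) : ℝ≥0∞) : EReal) ≤
      decayExponent μ (fun t => {ω | alg.empMean (ξ ω) (fun s i => Y s i ω) t ∈ A ∧
        alg.allocation (ξ ω) (fun s i => Y s i ω) t ∈ P}) := by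
  refine coe_le_of_forall_nnreal_lt (decayExponent_nonneg _) fun r hr => ?_
  refine of_forall_ultrafilter_exists_mem (D := A ×ˢ P)
    (p := fun U => ((r : ℝ) : EReal) ≤ decayExponent μ (fun t => {ω |
      (alg.empMean (ξ ω) (fun s i => Y s i ω) t,
        alg.allocation (ξ ω) (fun s i => Y s i ω) t) ∈ U})) ?_ ?_ ?_ ?_
  · exact le_top.trans_eq decayExponent_empty.symm
  · exact fun V hV W hWV => hV.trans
      (decayExponent_anti_of_eventually (Eventually.of_forall fun t ω hω => hWV hω))
  · exact fun V hV W hW => le_decayExponent_union hV hW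
  intro f hf
  have hfA : ∀ᶠ z in (f : Filter ((Fin K → ℝ) × (Fin K → ℝ))), z.1 ∈ A :=
    mem_of_superset hf fun z hz => hz.1
  have hfP : ∀ᶠ z in (f : Filter ((Fin K → ℝ) × (Fin K → ℝ))), z.2 ∈ P :=
    mem_of_superset hf fun z hz => hz.2
  obtain ⟨q, hqS, hq⟩ := (isCompact_stdSimplex ℝ (Fin K)).ultrafilter_le_nhds' (f.map Prod.snd)
    (hfP.mono fun z hz => hP hz)
  have hqt : Tendsto Prod.snd (f : Filter ((Fin K → ℝ) × (Fin K → ℝ))) (𝓝 q) := hq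
  have hrq : (r : ℝ≥0∞) < max (⨅ l ∈ A, Psi v θ l q) (I q) :=
    hr.trans_le (iInf₂_le q (mem_closure_of_tendsto hqt hfP))
  rcases lt_max_iff.1 hrq with hrq | hrq
  · obtain ⟨c, hrc, hc⟩ := ENNReal.lt_iff_exists_nnreal_btwn.1 hrq
    obtain ⟨η, hη⟩ := exists_eventually_le_tiltExponent hv θ q f hqS.1 hqt
      (r := r) (c := c) (by exact_mod_cast hrc) (hfA.mono fun z hz => by
        have h := hc.le.trans (iInf₂_le z.1 hz)
        rw [Psi_eq_ofReal hv θ z.1 hqS.1, ← ENNReal.ofReal_coe_nnreal] at h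
        refine (ENNReal.ofReal_le_ofReal_iff (Finset.sum_nonneg fun i _ => ?_)).1 h
        exact mul_nonneg (hqS.1 i) (by positivity))
    exact ⟨_, hη, le_decayExponent_tiltExponent hY alg η r⟩
  · obtain ⟨V, ⟨hVq, hVc⟩, hV⟩ := (closed_nhds_basis q).mem_iff.1
      (eventually_nhdsWithin_iff.1 (hI.1 q hqS r hrq))
    refine ⟨{z | z.2 ∈ V ∩ stdSimplex ℝ (Fin K)}, ?_, le_trans ?_ (hI.2 V hVc)⟩
    · filter_upwards [hqt hVq, hfP] with z hz hzP using ⟨hz, hP hzP⟩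
    · rw [← EReal.coe_nnreal_eq_coe_real, EReal.coe_ennreal_le_coe_ennreal_iff]
      exact le_iInf₂ fun x hx => (hV hx.1 hx.2).le

/-! ### The rate function of the empirical means -/

/-- Joint lower semicontinuity of `(l, q) ↦ max {Ψ_θ(l, q), I(q)}`. -/
lemma eventually_lt_max_Psi (hv : 0 < v) {I : (Fin K → ℝ) → ℝ≥0∞}
    (hI : LowerSemicontinuousOn I (stdSimplex ℝ (Fin K))) {l q : Fin K → ℝ}
    (hq : q ∈ stdSimplex ℝ (Fin K)) {y : ℝ≥0∞} (hy : y < max (Psi v θ l q) (I q)) :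
    ∀ᶠ z in 𝓝 (l, q), z.2 ∈ stdSimplex ℝ (Fin K) → y < max (Psi v θ z.1 z.2) (I z.2) := by
  rcases lt_max_iff.1 hy with hy | hy
  · have hcont : Continuous fun z : (Fin K → ℝ) × (Fin K → ℝ) =>
        ENNReal.ofReal (∑ i, z.2 i * ((z.1 i - θ i) ^ 2 / (2 * v))) :=
      ENNReal.continuous_ofReal.comp (by fun_prop)
    rw [Psi_eq_ofReal hv θ l hq.1] at hy
    filter_upwards [hcont.continuousAt.eventually_const_lt hy] with z hz hzS
    rw [Psi_eq_ofReal hv θ z.1 hzS.1]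
    exact lt_max_of_lt_left hz
  · filter_upwards [continuousAt_snd.eventually (eventually_nhdsWithin_iff.1 (hI q hq y hy))]
      with z hz hzS
    exact lt_max_of_lt_right (hz hzS)

lemma isLeast_meanRate (hv : 0 < v) (i : Fin K) {I : (Fin K → ℝ) → ℝ≥0∞}
    (hI : LowerSemicontinuousOn I (stdSimplex ℝ (Fin K))) (l : Fin K → ℝ) :
    IsLeast ((fun q => max (Psi v θ l q) (I q)) '' stdSimplex ℝ (Fin K))
      (meanRate v θ I l) := by
  have hlsc : LowerSemicontinuousOn (fun q => max (Psi v θ l q) (I q))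
      (stdSimplex ℝ (Fin K)) := fun q hq y hy =>
    eventually_nhdsWithin_iff.2 ((Continuous.prodMk_right l).continuousAt.eventually
      (eventually_lt_max_Psi hv hI hq hy))
  obtain ⟨q, hq, hmin⟩ := hlsc.exists_isMinOn ⟨_, single_mem_stdSimplex ℝ i⟩
    (isCompact_stdSimplex ℝ (Fin K))
  have hval : meanRate v θ I l = max (Psi v θ l q) (I q) :=
    le_antisymm (iInf₂_le q hq) (le_iInf₂ fun x hx => hmin hx)
  refine ⟨⟨q, hq, hval.symm⟩, ?_⟩
  rintro _ ⟨x, hx, rfl⟩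
  exact iInf₂_le x hx

lemma lowerSemicontinuousOn_meanRate (hv : 0 < v) (i : Fin K) {I : (Fin K → ℝ) → ℝ≥0∞}
    (hI : LowerSemicontinuousOn I (stdSimplex ℝ (Fin K))) :
    LowerSemicontinuousOn (meanRate v θ I) Set.univ := by
  intro l _ y hy
  rw [nhdsWithin_univ]
  have h : ∀ᶠ l' in 𝓝 l, ∀ q ∈ stdSimplex ℝ (Fin K), q ∈ stdSimplex ℝ (Fin K) →
      y < max (Psi v θ l' q) (I q) :=
    (isCompact_stdSimplex ℝ (Fin K)).eventually_forall_of_forall_eventually fun q hq =>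
      eventually_lt_max_Psi hv hI hq (hy.trans_le (iInf₂_le q hq))
  filter_upwards [h] with l' hl'
  obtain ⟨q, hq, hval⟩ := (isLeast_meanRate hv i hI l').1
  rw [← hval]
  exact hl' q hq hq

lemma Algorithm.allocation_mem_stdSimplex (alg : Algorithm K U) (u : U) (y : ℕ → Fin K → ℝ)
    {t : ℕ} (ht : t ≠ 0) : alg.allocation u y t ∈ stdSimplex ℝ (Fin K) := by
  refine ⟨fun i => by unfold allocation; positivity, ?_⟩
  have hcard : ∑ i, alg.count u y t i = t := by
    have h := Finset.card_eq_sum_card_fiberwise (s := Finset.range t) (t := Finset.univ)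
      (f := fun s => alg.arm t u y s) (fun _ _ => Finset.mem_coe.2 (Finset.mem_univ _))
    rw [Finset.card_range] at h
    exact h.symm
  unfold allocation
  rw [← Finset.sum_div, ← Nat.cast_sum, hcard]
  exact div_self (by exact_mod_cast ht)

end Joint

end GaussianBandit

theorem mainTheorem5 {Ω U : Type*} [MeasurableSpace Ω] [MeasurableSpace U]
    (μ : Measure Ω) [IsProbabilityMeasure μ]
    {K : ℕ} (θ : Fin K → ℝ) (best : Fin K) (hbest : GaussianBandit.IsUniqueBestArm θ best)
    (v : ℝ≥0) (hv : 0 < v)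
    (Y : ℕ → Fin K → Ω → ℝ) (ξ : Ω → U) (hY : GaussianBandit.IsGaussianModel μ θ v Y ξ)
    (alg : GaussianBandit.Algorithm K U)
    (p m : ℕ → Ω → Fin K → ℝ)
    (hp : p = fun t ω => alg.allocation (ξ ω) (fun s i => Y s i ω) t)
    (hm : m = fun t ω => alg.empMean (ξ ω) (fun s i => Y s i ω) t)
    (I : (Fin K → ℝ) → ℝ≥0∞)
    (hI : GaussianBandit.SatisfiesLDPUpperBound μ (stdSimplex ℝ (Fin K)) p I) :
    ((∀ l : Fin K → ℝ,
        IsLeast ((fun q => max (GaussianBandit.Psi v θ l q) (I q)) '' stdSimplex ℝ (Fin K))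
          (GaussianBandit.meanRate v θ I l)) ∧
      GaussianBandit.SatisfiesLDPUpperBound μ Set.univ m (GaussianBandit.meanRate v θ I)) ∧
    (∀ n : ℕ, 2 ≤ n → n ≤ K → ∀ J : Finset (Fin K), J.card = n → best ∈ J →
      ∀ M : Set (Fin K → ℝ), M = {l | ∀ i ∈ J, l best ≤ l i} →
      ∀ P : Set (Fin K → ℝ), P ⊆ stdSimplex ℝ (Fin K) → MeasurableSet P →
        ((⨅ q ∈ closure P, max (GaussianBandit.F v θ M q) (I q) : ℝ≥0∞) : EReal) ≤
          GaussianBandit.decayExponent μ (fun t => {ω | m t ω ∈ M ∧ p t ω ∈ P})) := by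
  subst hp hm
  have hjoint := GaussianBandit.iInf_max_le_decayExponent hv hY alg hI
  refine ⟨⟨fun l => GaussianBandit.isLeast_meanRate hv best hI.1 l,
    GaussianBandit.lowerSemicontinuousOn_meanRate hv best hI.1, fun C _ => ?_⟩, ?_⟩
  · refine (EReal.coe_ennreal_le_coe_ennreal_iff.2 ?_).trans
      ((hjoint C (stdSimplex ℝ (Fin K)) subset_rfl).trans ?_)
    · rw [(isClosed_stdSimplex ℝ (Fin K)).closure_eq]
      refine le_iInf₂ fun q hq => ?_
      rw [iInf_sup_eq, Set.inter_univ]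
      refine le_iInf fun l => ?_
      rw [iInf_sup_eq]
      refine le_iInf fun hl => ?_
      exact (iInf₂_le l hl).trans (iInf₂_le q hq)
    · -- At `t = 0` the allocation is the junk value `0`, which is not in the simplex.
      refine GaussianBandit.decayExponent_anti_of_eventually ?_
      filter_upwards [eventually_ne_atTop 0] with t ht ω hω
      exact ⟨hω.1, alg.allocation_mem_stdSimplex _ _ ht⟩
  · rintro n - - J - - M - P hP -
    refine (EReal.coe_ennreal_le_coe_ennreal_iff.2 ?_).trans (hjoint M P hP)
    exact iInf₂_mono fun q _ => max_le_max (iInf_le_iInf_of_subset subset_closure) le_rfl
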